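/- Let $\Gamma$ be a compact metric graph, that is, a connected graph with finitely many vertices and $E\ge 1$ edges (loops and multiple edges are allowed), each edge $e$ being identified with an interval of finite length $\ell_e>0$. Let $\Gamma$ be equipped with the shortest-path distance $\operatorname{dist}$ and with the Lebesgue measure $dx$ on every edge, and let $|\Gamma|=\sum_e \ell_e$ be its total length. Define the mean distance on $\Gamma$ by $$\rho(\Gamma)=\frac{1}{|\Gamma|^2}\int_\Gamma\int_\Gamma \operatorname{dist}(x,y)\,dy\,dx$$ and the spectral gap of $\Gamma$ by $$\mu_2(\Gamma)=\inf\left\{\frac{\|u'\|_{L^2(\Gamma)}^2}{\|u\|_{L^2(\Gamma)}^2} : 0\neq u\in H^1(\Gamma),\ \int_\Gamma u\,dx=0\right\},$$ where $H^1(\Gamma)$ is the space of continuous real-valued functions $u$ on $\Gamma$ with a weak derivative $u'\in L^2(\Gamma)$ on the edges. Then $$\frac{2E-1}{4E^2}\le \mu_2(\Gamma)\,\rho(\Gamma)^2 .$$ -/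

import Mathlib

open MeasureTheory Set
open scoped ContDiff

noncomputable section

/-- A connected metric graph `(V, E, ℓ)` with vertex type `V` and edge type `E`. Every edge `e` is
a closed interval `[0, ℓ e]` of positive length, whose left end is glued to the vertex `src e` and
whose right end is glued to the vertex `tgt e`. Loops and multiple edges are allowed. -/
structure MetricGraph (V E : Type*) where
  /-- the vertex at the parameter value `0` of an edge -/
  src : E → V
  /-- the vertex at the parameter value `length e` of an edge -/
  tgt : E → V
  /-- the length of an edge -/
  length : E → ℝ
  length_pos : ∀ e, 0 < length e
  connected : ∀ v w : V,
    Relation.ReflTransGen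
      (fun a b => ∃ e, (src e = a ∧ tgt e = b) ∨ (src e = b ∧ tgt e = a)) v w

namespace MetricGraph

variable {V E : Type*} (G : MetricGraph V E)

/-- The points of a metric graph: the disjoint union of the closed edges. The gluing at the
vertices is done by the pseudo-metric below: end points of edges that are attached to the same
vertex have distance `0`. -/
def Point : Type _ := Σ e : E, Icc (0 : ℝ) (G.length e)

variable {G} in
/-- The point `p` is an end point of its edge, attached to the vertex `v`. -/
def Point.AtVertex (p : G.Point) (v : V) : Prop :=
  ((p.2 : ℝ) = 0 ∧ G.src p.1 = v) ∨ ((p.2 : ℝ) = G.length p.1 ∧ G.tgt p.1 = v)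

/-- The point of the edge `e` with parameter `x`, for `x ∈ [0, ℓ e]` (for other real numbers, the
nearest end point of the edge). -/
def pt (e : E) (x : ℝ) : G.Point := ⟨e, projIcc 0 (G.length e) (G.length_pos e).le x⟩

/-- `G.Path p q r`: there is a path of length `r` from `p` to `q`, consisting of finitely many
segments, each contained in one edge, with changes of edge only at common vertices. -/
inductive Path : G.Point → G.Point → ℝ → Prop
  | refl (p : G.Point) : Path p p 0
  | along {p : G.Point} {r : ℝ} (e : E) (s t : Icc (0 : ℝ) (G.length e)) :
      Path p ⟨e, s⟩ r → Path p ⟨e, t⟩ (r + |(s : ℝ) - t|)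
  | cross {p q q' : G.Point} {r : ℝ} (v : V) :
      Path p q r → q.AtVertex v → q'.AtVertex v → Path p q' r

variable {G} in
theorem Path.trans {p q w : G.Point} {a b : ℝ} (h : G.Path p q a) (h' : G.Path q w b) :
    G.Path p w (a + b) := by
  induction h' with
  | refl => simpa using h
  | along e s t _ ih => rw [← add_assoc]; exact ih.along e s t
  | cross v _ h1 h2 ih => exact ih.cross v h1 h2

variable {G} in
theorem Path.symm {p q : G.Point} {a : ℝ} (h : G.Path p q a) : G.Path q p a := by
  induction h with
  | refl => exact Path.refl _
  | along e s t _ ih =>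
    have := ((Path.refl (G := G) ⟨e, t⟩).along e t s).trans ih
    rwa [zero_add, add_comm, abs_sub_comm] at this
  | @cross q q' r v _ h1 h2 ih =>
    have := ((Path.refl _).cross v h2 h1).trans ih
    rwa [zero_add] at this

variable {G} in
theorem Path.nonneg {p q : G.Point} {a : ℝ} (h : G.Path p q a) : 0 ≤ a := by
  induction h with
  | refl => exact le_rfl
  | along e s t _ ih => positivity
  | cross v _ _ _ ih => exact ih

theorem exists_path (p q : G.Point) : ∃ r, G.Path p q r := by
  have key : ∀ v w : V, Relation.ReflTransGen
      (fun a b => ∃ e, (G.src e = a ∧ G.tgt e = b) ∨ (G.src e = b ∧ G.tgt e = a)) v w →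
      ∀ p : G.Point, p.AtVertex v → ∃ q : G.Point, q.AtVertex w ∧ ∃ r, G.Path p q r := by
    intro v w h p hp
    induction h with
    | refl => exact ⟨p, hp, 0, Path.refl p⟩
    | tail _ hbc ih =>
      obtain ⟨q, hq, r, hr⟩ := ih
      obtain ⟨e, ⟨h1, h2⟩ | ⟨h1, h2⟩⟩ := hbc
      · exact ⟨⟨e, ⟨G.length e, (G.length_pos e).le, le_rfl⟩⟩, Or.inr ⟨rfl, h2⟩, _,
          (hr.cross (q' := ⟨e, ⟨0, le_rfl, (G.length_pos e).le⟩⟩) _ hq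
            (Or.inl ⟨rfl, h1⟩)).along e _ _⟩
      · exact ⟨⟨e, ⟨0, le_rfl, (G.length_pos e).le⟩⟩, Or.inl ⟨rfl, h1⟩, _,
          (hr.cross (q' := ⟨e, ⟨G.length e, (G.length_pos e).le, le_rfl⟩⟩) _ hq
            (Or.inr ⟨rfl, h2⟩)).along e _ _⟩
  obtain ⟨e, s⟩ := p
  obtain ⟨f, t⟩ := q
  obtain ⟨z, hz, r, hr⟩ := key _ _ (G.connected (G.src e) (G.src f))
    ⟨e, ⟨0, le_rfl, (G.length_pos e).le⟩⟩ (Or.inl ⟨rfl, rfl⟩)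
  have h1 := (((Path.refl (G := G) ⟨e, s⟩).along e s ⟨0, le_rfl, (G.length_pos e).le⟩).trans
    hr).cross (q' := ⟨f, ⟨0, le_rfl, (G.length_pos f).le⟩⟩) _ hz (Or.inl ⟨rfl, rfl⟩)
  exact ⟨_, h1.along f _ t⟩

theorem bddBelow_path (p q : G.Point) : BddBelow {r | G.Path p q r} :=
  ⟨0, fun _ h => Path.nonneg h⟩

/-- The shortest-path pseudo-metric: the distance of two points is the infimum of the lengths of
the paths between them. -/
instance : PseudoMetricSpace G.Point where
  dist p q := sInf {r | G.Path p q r}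
  dist_self p := le_antisymm (csInf_le (G.bddBelow_path p p) (Path.refl p))
    (Real.sInf_nonneg fun _ h => Path.nonneg h)
  dist_comm p q := congrArg sInf (Set.ext fun _ => ⟨Path.symm, Path.symm⟩)
  dist_triangle p q w := by
    refine le_of_forall_pos_le_add fun ε hε => ?_
    obtain ⟨a, ha, ha'⟩ := Real.lt_sInf_add_pos (G.exists_path p q) (half_pos hε)
    obtain ⟨b, hb, hb'⟩ := Real.lt_sInf_add_pos (G.exists_path q w) (half_pos hε)
    have h : sInf {r | G.Path p w r} ≤ a + b := csInf_le (G.bddBelow_path p w) (Path.trans ha hb)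
    have h1 : a < sInf {r | G.Path p q r} + ε / 2 := ha'
    have h2 : b < sInf {r | G.Path q w r} + ε / 2 := hb'
    linarith

section Fintype

variable [Fintype E]

/-- The total length of the graph. -/
def totalLength : ℝ := ∑ e, G.length e

/-- The integral over the graph, with respect to the Lebesgue measure on every edge. -/
def integral (f : G.Point → ℝ) : ℝ :=
  ∑ e, ∫ x in (0 : ℝ)..G.length e, f (G.pt e x)

/-- The mean distance from the point `p`. -/
def meanDistFrom (p : G.Point) : ℝ :=
  1 / G.totalLength * G.integral fun q => dist p q

/-- The mean distance on the graph. -/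
def meanDist : ℝ := 1 / G.totalLength * G.integral G.meanDistFrom

end Fintype

/-- `g` is a weak derivative of `f` on the open interval `(a, b)`. -/
def IsWeakDeriv (a b : ℝ) (f g : ℝ → ℝ) : Prop :=
  ∀ φ : ℝ → ℝ, ContDiff ℝ ∞ φ → HasCompactSupport φ → tsupport φ ⊆ Ioo a b →
    ∫ x in a..b, f x * deriv φ x = -∫ x in a..b, g x * φ x

/-- `u` belongs to the Sobolev space `H¹` of the graph and has the derivative `g`: the function `u`
is continuous on the graph (hence square integrable), and `g e`, which is square integrable on
`(0, ℓ e)`, is the weak derivative of `u` on every edge `e`. -/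
structure IsH1WithDeriv (u : G.Point → ℝ) (g : E → ℝ → ℝ) : Prop where
  continuous : Continuous u
  memLp : ∀ e, MemLp (g e) 2 (volume.restrict (Ioo 0 (G.length e)))
  weakDeriv : ∀ e, IsWeakDeriv 0 (G.length e) (fun x => u (G.pt e x)) (g e)

/-- The spectral gap `μ₂`: the infimum of the Rayleigh quotients `‖u'‖² / ‖u‖²` over all nonzero
`u` in `H¹` of the graph with mean value zero. -/
def spectralGap [Fintype E] : ℝ :=
  sInf {r : ℝ | ∃ (u : G.Point → ℝ) (g : E → ℝ → ℝ), G.IsH1WithDeriv u g ∧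
    G.integral u = 0 ∧ u ≠ 0 ∧
    r = (∑ e, ∫ x in (0 : ℝ)..G.length e, g e x ^ 2) / G.integral fun p => u p ^ 2}

end MetricGraph

end

/-! Write `L` for the total length, `E` for the number of edges, `ρ` for the mean distance and `N`,
`D` for the squared norms of `u'` and `u`. The proof combines two bounds, `μ₂ ≥ 2 / (L ρ)` and `ρ ≥
L / (4 E)`, which give `μ₂ ρ² ≥ 2 ρ / L ≥ 1 / (2 E)`, slightly more than is claimed.

The first rests on the Hölder estimate `(u q - u p)² ≤ N * dist p q` (`sq_sub_le_mul_dist`).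
Integrated over all pairs, with the cross term killed by the zero mean, it reads `2 L D ≤ N L² ρ`.
Cauchy-Schwarz along a path is not enough for the estimate, because a `Path` may run through the
same place repeatedly and would count its energy more than once. Hence the energy is sorted by the
values of `u`: successive segments are charged to disjoint bands of values
(`sq_sub_le_mul_levelEnergy`).

For the second, collapsing everything outside an edge `e` to one point turns `e` into a circle of
length `ℓ e` and does not increase distances. On this circle the mean distance from any point is `ℓ
e / 4`, so the distance from any point of the graph has integral at least `ℓ e ^ 2 / 4` over `e`.
Summation over `e` and Cauchy-Schwarz finish the bound. -/

/-! ### Weak derivatives on an interval -/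

namespace MetricGraph

/-- A test function on `(a, b)` with vanishing integral is the derivative of a test function. -/
theorem exists_deriv_eq_of_integral_eq_zero {a b : ℝ} (hab : a < b) {ψ : ℝ → ℝ}
    (hψ : ContDiff ℝ ∞ ψ) (hs : HasCompactSupport ψ) (ht : tsupport ψ ⊆ Ioo a b)
    (h0 : ∫ x, ψ x = 0) :
    ∃ φ : ℝ → ℝ, ContDiff ℝ ∞ φ ∧ HasCompactSupport φ ∧ tsupport φ ⊆ Ioo a b ∧ deriv φ = ψ := by
  -- The midpoint keeps the set nonempty when `ψ = 0`; its extreme points `c`, `d` then enclose the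
  -- support and stay inside `(a, b)`.
  have hc : IsCompact (insert ((a + b) / 2) (tsupport ψ)) := hs.isCompact.insert _
  have hsub : insert ((a + b) / 2) (tsupport ψ) ⊆ Ioo a b :=
    insert_subset ⟨by linarith, by linarith⟩ ht
  obtain ⟨c, hcm, hcl⟩ := hc.exists_isLeast (insert_nonempty _ _)
  obtain ⟨d, hdm, hdl⟩ := hc.exists_isGreatest (insert_nonempty _ _)
  have hzero : ∀ x, x ∉ Icc c d → ψ x = 0 := fun x hx => by
    by_contra hne
    have hx' := mem_insert_of_mem ((a + b) / 2) (subset_tsupport ψ hne)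
    exact hx ⟨hcl hx', hdl hx'⟩
  have hderiv : ∀ x, HasDerivAt (fun x => ∫ t in a..x, ψ t) (ψ x) x := fun x =>
    intervalIntegral.integral_hasDerivAt_right (hψ.continuous.intervalIntegrable _ _)
      (hψ.continuous.stronglyMeasurableAtFilter _ _) hψ.continuous.continuousAt
  have hdφ : deriv (fun x => ∫ t in a..x, ψ t) = ψ := funext fun x => (hderiv x).deriv
  have hsupp : Function.support (fun x => ∫ t in a..x, ψ t) ⊆ Icc c d := by
    intro x hx
    by_contra hne
    refine hx (?_ : ∫ t in a..x, ψ t = 0)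
    rcases not_and_or.1 hne with h | h
    · rw [intervalIntegral.integral_congr (g := fun _ => 0), intervalIntegral.integral_zero]
      intro t ht'
      refine hzero t fun htc => ?_
      have : t ≤ max a x := ht'.2
      have hm : max a x < c := max_lt (hsub hcm).1 (not_le.1 h)
      linarith [htc.1]
    -- To the right of `d` the primitive has collected the whole integral of `ψ`, which is zero.
    · rw [← h0, intervalIntegral.integral_of_le ((hsub hdm).1.le.trans (not_le.1 h).le)]
      refine setIntegral_eq_integral_of_forall_compl_eq_zero fun t ht' => hzero t fun htc => ht' ?_
      exact ⟨(hsub hcm).1.trans_le htc.1, htc.2.trans (not_le.1 h).le⟩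
  have htsupp := closure_minimal hsupp isClosed_Icc
  refine ⟨_, contDiff_infty_iff_deriv.2 ⟨fun x => (hderiv x).differentiableAt, ?_⟩,
    HasCompactSupport.intro isCompact_Icc fun x hx => by_contra fun h => hx (hsupp h), ?_, hdφ⟩
  · rwa [hdφ]
  · exact htsupp.trans (Icc_subset_Ioo (hsub hcm).1 (hsub hdm).2)

/-- The lemma of du Bois-Reymond: a continuous function whose weak derivative vanishes is
constant. -/
theorem exists_eq_const_of_integral_mul_deriv_eq_zero {a b : ℝ} (hab : a < b) {w : ℝ → ℝ}
    (hw : ContinuousOn w (Icc a b))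
    (h : ∀ φ : ℝ → ℝ, ContDiff ℝ ∞ φ → HasCompactSupport φ → tsupport φ ⊆ Ioo a b →
      ∫ x in a..b, w x * deriv φ x = 0) :
    ∃ c, ∀ x ∈ Icc a b, w x = c := by
  let B : ContDiffBump ((a + b) / 2) :=
    ⟨(b - a) / 8, (b - a) / 4, by linarith, by linarith⟩
  have hB : ContDiff ℝ ∞ (B.normed volume) := B.contDiff_normed
  have hBc : HasCompactSupport (B.normed volume) := B.hasCompactSupport_normed
  have hBt : tsupport (B.normed volume) ⊆ Ioo a b := by
    rw [B.tsupport_normed_eq, Real.closedBall_eq_Icc]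
    exact Icc_subset_Ioo (by simp only [B]; linarith) (by simp only [B]; linarith)
  have hint : ∀ ψ : ℝ → ℝ, Continuous ψ → IntervalIntegrable (fun x => w x * ψ x) volume a b :=
    fun ψ hψ => ContinuousOn.intervalIntegrable (by
      rw [uIcc_of_le hab.le]; exact hw.mul hψ.continuousOn)
  set c := ∫ x in a..b, w x * B.normed volume x with hcdef
  have key : ∀ ψ : ℝ → ℝ, ContDiff ℝ ∞ ψ → HasCompactSupport ψ → tsupport ψ ⊆ Ioo a b →
      ∫ x, ψ x • (w x - c) ∂(volume.restrict (Ioo a b)) = 0 := by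
    intro ψ hψ hψc hψt
    have hψi : ∫ x, ψ x = ∫ x in a..b, ψ x := by
      rw [intervalIntegral.integral_of_le hab.le]
      refine (setIntegral_eq_integral_of_forall_compl_eq_zero fun t ht => ?_).symm
      exact by_contra fun hne => ht (Ioo_subset_Ioc_self (hψt (subset_tsupport _ hne)))
    -- Subtracting a multiple of the unit-mass bump makes the integral zero, so the difference is an
    -- admissible `deriv φ`; the weighted mean `c` is what the bump contributes.
    obtain ⟨φ, h1, h2, h3, h4⟩ := exists_deriv_eq_of_integral_eq_zero hab
      (ψ := fun x => ψ x - (∫ x, ψ x) * B.normed volume x)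
      (hψ.sub (contDiff_const.mul hB))
      (hψc.sub hBc.mul_left)
      ((tsupport_sub _ _).trans (union_subset hψt ((tsupport_mul_subset_right).trans hBt)))
      (by
        rw [integral_sub (hψ.continuous.integrable_of_hasCompactSupport hψc)
          ((hB.continuous.integrable_of_hasCompactSupport hBc).const_mul _),
          integral_const_mul, B.integral_normed, mul_one, sub_self])
    have h5 := h φ h1 h2 h3
    rw [h4] at h5
    have h6 : ∀ x, w x * (ψ x - (∫ x, ψ x) * B.normed volume x) =
      w x * ψ x - (∫ x, ψ x) * (w x * B.normed volume x) := fun x => by ring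
    simp_rw [h6] at h5
    rw [intervalIntegral.integral_sub (hint _ hψ.continuous) ((hint _ hB.continuous).const_mul _),
      intervalIntegral.integral_const_mul, ← hcdef, hψi] at h5
    rw [← integral_Ioc_eq_integral_Ioo, ← intervalIntegral.integral_of_le hab.le]
    have h7 : ∀ x, ψ x • (w x - c) = w x * ψ x - c * ψ x := fun x => by
      rw [smul_eq_mul]; ring
    simp_rw [h7]
    rw [intervalIntegral.integral_sub (hint _ hψ.continuous)
      ((hψ.continuous.intervalIntegrable _ _).const_mul _), intervalIntegral.integral_const_mul]
    linarith
  have hae := isOpen_Ioo.ae_eq_zero_of_integral_contDiff_smul_eq_zero (μ := volume)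
    (U := Ioo a b) (f := fun x => w x - c)
    (((hw.sub continuousOn_const).mono Ioo_subset_Icc_self).locallyIntegrableOn
      measurableSet_Ioo) (fun ψ h1 h2 h3 => by
        rw [← key ψ h1 h2 h3]
        refine (setIntegral_eq_integral_of_forall_compl_eq_zero fun t ht => ?_).symm
        have : ψ t = 0 := by_contra fun hne => ht (h3 (subset_tsupport _ hne))
        simp [this])
  refine ⟨c, Measure.eqOn_Icc_of_ae_eq volume hab.ne ?_ hw continuousOn_const⟩
  rw [Measure.restrict_congr_set Ioo_ae_eq_Icc.symm, Filter.EventuallyEq,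
    ae_restrict_iff' measurableSet_Ioo]
  filter_upwards [hae] with x hx hx' using sub_eq_zero.1 (hx hx')

/-- A continuous function is the primitive of its weak derivative. -/
theorem IsWeakDeriv.integral_eq_sub {a b : ℝ} (hab : a < b) {f g : ℝ → ℝ}
    (hf : ContinuousOn f (Icc a b)) (hg : IntervalIntegrable g volume a b)
    (h : IsWeakDeriv a b f g) {x y : ℝ} (hx : x ∈ Icc a b) (hy : y ∈ Icc a b) :
    ∫ t in x..y, g t = f y - f x := by
  have hIcc : uIcc a b = Icc a b := uIcc_of_le hab.le
  have hac := hg.absolutelyContinuousOnInterval_intervalIntegral (c := a) left_mem_uIcc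
  have hGc : ContinuousOn (fun x => ∫ t in a..x, g t) (Icc a b) := hIcc ▸ hac.continuousOn
  -- `f` and the primitive of `g` have the same weak derivative, the latter by integration by parts
  -- for absolutely continuous functions, so they differ by a constant.
  obtain ⟨c, hc⟩ := exists_eq_const_of_integral_mul_deriv_eq_zero hab (hf.sub hGc) (by
    intro φ h1 h2 h3
    have hφ : AbsolutelyContinuousOnInterval φ a b :=
      ((h1.of_le (by simp)).contDiffOn).absolutelyContinuousOnInterval
    have ha : φ a = 0 := by_contra fun hne => lt_irrefl _ (h3 (subset_tsupport _ hne)).1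
    have hb : φ b = 0 := by_contra fun hne => lt_irrefl _ (h3 (subset_tsupport _ hne)).2
    have hparts := hac.integral_mul_deriv_eq_deriv_mul hφ
    have hd : ∫ x in a..b, deriv (fun x => ∫ t in a..x, g t) x * φ x =
        ∫ x in a..b, g x * φ x := by
      refine intervalIntegral.integral_congr_ae ?_
      filter_upwards [hg.ae_hasDerivAt_integral] with x hx hx'
      rw [(hx (uIoc_subset_uIcc hx') a left_mem_uIcc).deriv]
    rw [hd, ha, hb] at hparts
    have hφ' : Continuous (deriv φ) := h1.continuous_deriv (by simp)
    have h4 : ∀ x, (f - fun x => ∫ t in a..x, g t) x * deriv φ x =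
      f x * deriv φ x - (∫ t in a..x, g t) * deriv φ x := fun x => by simp [sub_mul]
    simp_rw [h4]
    rw [intervalIntegral.integral_sub
      (ContinuousOn.intervalIntegrable (hIcc ▸ hf.mul hφ'.continuousOn))
      (ContinuousOn.intervalIntegrable (hIcc ▸ hGc.mul hφ'.continuousOn)), h φ h1 h2 h3, hparts]
    ring)
  have h1 := hc x hx
  have h2 := hc y hy
  simp only [Pi.sub_apply] at h1 h2
  have h3 := intervalIntegral.integral_add_adjacent_intervals
    (hg.mono_set (uIcc_subset_uIcc left_mem_uIcc (hIcc ▸ hx)))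
    (hg.mono_set (uIcc_subset_uIcc (hIcc ▸ hx) (hIcc ▸ hy)))
  linarith

/-- The Cauchy-Schwarz inequality against a constant. -/
theorem sq_integral_le {a b : ℝ} (hab : a ≤ b) {g : ℝ → ℝ} (hg : IntervalIntegrable g volume a b)
    (hg2 : IntervalIntegrable (fun t => g t ^ 2) volume a b) :
    (∫ t in a..b, g t) ^ 2 ≤ (b - a) * ∫ t in a..b, g t ^ 2 := by
  rcases hab.eq_or_lt with rfl | hlt
  · simp
  set m := ∫ t in a..b, g t with hm
  have h := intervalIntegral.integral_nonneg (μ := volume) hab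
    (fun t _ => sq_nonneg ((b - a) * g t - m))
  have h1 : ∀ t, ((b - a) * g t - m) ^ 2 =
    (b - a) ^ 2 * g t ^ 2 - 2 * (b - a) * m * g t + m ^ 2 := fun t => by ring
  simp_rw [h1] at h
  rw [intervalIntegral.integral_add ((hg2.const_mul _).sub (hg.const_mul _)) (by simp),
    intervalIntegral.integral_sub (hg2.const_mul _) (hg.const_mul _),
    intervalIntegral.integral_const_mul, intervalIntegral.integral_const_mul, ← hm,
    intervalIntegral.integral_const, smul_eq_mul] at h
  have h2 : 0 ≤ (b - a) * ((b - a) * (∫ t in a..b, g t ^ 2) - m ^ 2) := by linarith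
  linarith [nonneg_of_mul_nonneg_right h2 (sub_pos.2 hlt)]

/-- If `f` passes from below `α` to above `β` between `x` and `y`, then the energy of `f` between
these levels is at least `(β - α) ^ 2 / |x - y|`. -/
theorem sq_sub_le_mul_integral_indicator {a b : ℝ} {f g : ℝ → ℝ} (hf : Continuous f)
    (hg : IntervalIntegrable g volume a b)
    (hg2 : IntervalIntegrable (fun t => g t ^ 2) volume a b)
    (h : ∀ x ∈ Icc a b, ∀ y ∈ Icc a b, ∫ t in x..y, g t = f y - f x)
    {x y α β : ℝ} (hx : x ∈ Icc a b) (hy : y ∈ Icc a b) (hαβ : α ≤ β)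
    (hα : f x ≤ α) (hβ : β ≤ f y) :
    (β - α) ^ 2 ≤
      |x - y| * ∫ t in a..b, {t | α < f t ∧ f t < β}.indicator (fun t => g t ^ 2) t := by
  wlog hxy : x ≤ y generalizing f g x y α β
  · have := this (f := fun t => -f t) (g := fun t => -g t) hf.neg hg.neg (by simpa using hg2)
      (fun x hx y hy => by rw [intervalIntegral.integral_neg, h x hx y hy]; ring) hy hx
      (neg_le_neg hαβ) (neg_le_neg hβ) (neg_le_neg hα) (le_of_not_ge hxy)
    have hset : {t | -β < -f t ∧ -f t < -α} = {t | α < f t ∧ f t < β} := by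
      ext t; simp [and_comm]
    rw [hset, abs_sub_comm] at this
    simpa [neg_add_eq_sub] using this
  -- `y'` is the first point after `x` where `f` reaches `β`, and `x'` the last point before `y'`
  -- where `f ≤ α`. Strictly between them `f` stays in the open band, so the indicator is `1` there.
  obtain ⟨y', ⟨hy'1, hy'2⟩, hy'3⟩ :=
    (isCompact_Icc.inter_right (isClosed_le continuous_const hf) :
      IsCompact (Icc x y ∩ {t | β ≤ f t})).exists_isLeast ⟨y, ⟨hxy, le_rfl⟩, hβ⟩
  obtain ⟨x', ⟨hx'1, hx'2⟩, hx'3⟩ :=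
    (isCompact_Icc.inter_right (isClosed_le hf continuous_const) :
      IsCompact (Icc x y' ∩ {t | f t ≤ α})).exists_isGreatest ⟨x, ⟨le_rfl, hy'1.1⟩, hα⟩
  have hmid : ∀ t ∈ Ioo x' y', α < f t ∧ f t < β := fun t ht =>
    ⟨not_le.1 fun hle => absurd (hx'3 ⟨⟨hx'1.1.trans ht.1.le, ht.2.le⟩, hle⟩) (not_le.2 ht.1),
      not_le.1 fun hle => absurd (hy'3 ⟨⟨hx'1.1.trans ht.1.le, ht.2.le.trans hy'1.2⟩, hle⟩)
        (not_le.2 ht.2)⟩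
  have hab : a ≤ b := hx.1.trans hx.2
  have hx'm : x' ∈ Icc a b := ⟨hx.1.trans hx'1.1, (hx'1.2.trans hy'1.2).trans hy.2⟩
  have hy'm : y' ∈ Icc a b := ⟨hx.1.trans hy'1.1, hy'1.2.trans hy.2⟩
  have hsub : uIcc x' y' ⊆ uIcc a b := uIcc_subset_uIcc (uIcc_of_le hab ▸ hx'm)
    (uIcc_of_le hab ▸ hy'm)
  have h1 := sq_integral_le hx'1.2 (hg.mono_set hsub) (hg2.mono_set hsub)
  rw [h x' hx'm y' hy'm] at h1
  have hmeas : MeasurableSet {t | α < f t ∧ f t < β} :=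
    ((isOpen_lt continuous_const hf).inter (isOpen_lt hf continuous_const)).measurableSet
  have h2 : ∫ t in x'..y', g t ^ 2 ≤
      ∫ t in a..b, {t | α < f t ∧ f t < β}.indicator (fun t => g t ^ 2) t := by
    have hle : ∫ t in x'..y', g t ^ 2 =
        ∫ t in x'..y', {t | α < f t ∧ f t < β}.indicator (fun t => g t ^ 2) t := by
      rw [intervalIntegral.integral_of_le hx'1.2, intervalIntegral.integral_of_le hx'1.2,
        integral_Ioc_eq_integral_Ioo, integral_Ioc_eq_integral_Ioo]
      exact setIntegral_congr_fun measurableSet_Ioo fun t ht =>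
        (indicator_of_mem (s := {t | α < f t ∧ f t < β}) (hmid t ht) (fun t => g t ^ 2)).symm
    rw [hle]
    refine intervalIntegral.integral_mono_interval hx'm.1 hx'1.2 hy'm.2
      (Filter.Eventually.of_forall fun t => indicator_nonneg (fun _ _ => sq_nonneg _) t) ?_
    rw [intervalIntegrable_iff] at hg2 ⊢
    exact hg2.indicator hmeas
  have h3 : 0 ≤ ∫ t in x'..y', g t ^ 2 :=
    intervalIntegral.integral_nonneg hx'1.2 fun _ _ => sq_nonneg _
  calc (β - α) ^ 2 ≤ (f y' - f x') ^ 2 :=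
        pow_le_pow_left₀ (sub_nonneg.2 hαβ) (sub_le_sub hy'2 hx'2) 2
    _ ≤ (y' - x') * ∫ t in x'..y', g t ^ 2 := h1
    _ ≤ |x - y| * ∫ t in x'..y', g t ^ 2 := by
        refine mul_le_mul_of_nonneg_right ?_ h3
        rw [abs_sub_comm, abs_of_nonneg (sub_nonneg.2 hxy)]
        exact sub_le_sub hy'1.2 hx'1.1
    _ ≤ _ := mul_le_mul_of_nonneg_left h2 (abs_nonneg _)

end MetricGraph

namespace MetricGraph

variable {V E : Type*} (G : MetricGraph V E)

/-! ### The shortest-path distance -/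

variable {G} in
/-- A function that is Lipschitz along every edge and compatible with the gluing at the vertices is
Lipschitz along every path. -/
theorem Path.abs_sub_le {φ : G.Point → ℝ} {K : ℝ}
    (hedge : ∀ e (s t : Icc (0 : ℝ) (G.length e)),
      |φ ⟨e, t⟩ - φ ⟨e, s⟩| ≤ K * |(s : ℝ) - t|)
    (hvert : ∀ (p q : G.Point) (v : V), p.AtVertex v → q.AtVertex v → φ p = φ q)
    {p q : G.Point} {r : ℝ} (h : G.Path p q r) : |φ q - φ p| ≤ K * r := by
  induction h with
  | refl => simp
  | along e s t _ ih =>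
    rw [mul_add]
    linarith [hedge e s t, _root_.abs_sub_le (φ ⟨e, t⟩) (φ ⟨e, s⟩) (φ p)]
  | cross v _ h1 h2 ih => rwa [← hvert _ _ v h1 h2]

theorem le_mul_dist {p q : G.Point} {c K : ℝ} (hK : 0 ≤ K)
    (h : ∀ r, G.Path p q r → c ≤ K * r) : c ≤ K * dist p q := by
  obtain ⟨r₀, hr₀⟩ := G.exists_path p q
  rcases hK.eq_or_lt with rfl | hpos
  · simpa using h r₀ hr₀
  · rw [← div_le_iff₀' hpos]
    exact le_csInf ⟨r₀, hr₀⟩ fun r hr => (div_le_iff₀' hpos).2 (h r hr)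

variable {G} in
theorem Path.dist_le {p q : G.Point} {r : ℝ} (h : G.Path p q r) : dist p q ≤ r :=
  csInf_le (G.bddBelow_path p q) h

/-- Since `dist` is an infimum over paths, lower bounds for it come from testing with Lipschitz
functions. The lemma also yields continuity of functions defined edge by edge. -/
theorem abs_sub_le_mul_dist {φ : G.Point → ℝ} {K : ℝ} (hK : 0 ≤ K)
    (hedge : ∀ e (s t : Icc (0 : ℝ) (G.length e)),
      |φ ⟨e, t⟩ - φ ⟨e, s⟩| ≤ K * |(s : ℝ) - t|)
    (hvert : ∀ (p q : G.Point) (v : V), p.AtVertex v → q.AtVertex v → φ p = φ q)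
    (p q : G.Point) : |φ q - φ p| ≤ K * dist p q :=
  G.le_mul_dist hK fun _ hr => hr.abs_sub_le hedge hvert

theorem dist_eq_zero_of_atVertex {p q : G.Point} {v : V} (hp : p.AtVertex v)
    (hq : q.AtVertex v) : dist p q = 0 :=
  le_antisymm ((Path.refl p).cross v hp hq).dist_le dist_nonneg

theorem dist_mk_le (e : E) (s t : Icc (0 : ℝ) (G.length e)) :
    dist (α := G.Point) ⟨e, s⟩ ⟨e, t⟩ ≤ |(s : ℝ) - t| := by
  simpa using ((Path.refl (G := G) ⟨e, s⟩).along e s t).dist_le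

theorem continuous_pt (e : E) : Continuous (G.pt e) := by
  have h : LipschitzWith (β := G.Point) 1 (fun s : Icc (0 : ℝ) (G.length e) => ⟨e, s⟩) :=
    LipschitzWith.of_dist_le_mul fun s t => by
      simpa [Subtype.dist_eq, Real.dist_eq] using G.dist_mk_le e s t
  exact h.continuous.comp continuous_projIcc

theorem pt_val (e : E) (s : Icc (0 : ℝ) (G.length e)) : G.pt e s = ⟨e, s⟩ := by
  rw [pt, projIcc_val]

theorem pt_of_mem {e : E} {x : ℝ} (hx : x ∈ Icc 0 (G.length e)) : G.pt e x = ⟨e, ⟨x, hx⟩⟩ :=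
  G.pt_val e ⟨x, hx⟩

/-! ### The lower bound for the mean distance -/

/-- The circle distance from `s` on the edge `e`, continued by a constant to the rest of the
graph, bounds the distance from the point `s` of `e` from below. -/
theorem min_le_dist (e : E) (s : Icc (0 : ℝ) (G.length e)) {p : G.Point}
    (hp : p = ⟨e, s⟩ ∨ p.1 ≠ e ∧ (s : ℝ) = 0) (t : Icc (0 : ℝ) (G.length e)) :
    min |(s : ℝ) - t| (G.length e - |(s : ℝ) - t|) ≤ dist p ⟨e, t⟩ := by
  classical
  let φ : G.Point → ℝ := fun q =>
    if q.1 = e then min |(s : ℝ) - q.2| (G.length e - |(s : ℝ) - q.2|)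
    else min (s : ℝ) (G.length e - s)
  have hφe : ∀ x : Icc (0 : ℝ) (G.length e),
      φ ⟨e, x⟩ = min |(s : ℝ) - x| (G.length e - |(s : ℝ) - x|) := fun x => if_pos rfl
  -- Both ends of `e` are one point of the circle, so the circle distance agrees there and extends
  -- by a constant.
  have hv : ∀ (q : G.Point) (v : V), q.AtVertex v → φ q = min (s : ℝ) (G.length e - s) := by
    rintro ⟨f, x⟩ v hq
    by_cases hf : f = e
    · subst hf
      rw [hφe]
      rcases hq with ⟨h, -⟩ | ⟨h, -⟩ <;> simp only at h <;> rw [h]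
      · rw [sub_zero, abs_of_nonneg s.2.1]
      · rw [abs_sub_comm, abs_of_nonneg (sub_nonneg.2 s.2.2), sub_sub_cancel, min_comm]
    · exact if_neg hf
  have key := G.abs_sub_le_mul_dist (φ := φ) zero_le_one (fun f x y => by
    by_cases hf : f = e
    · subst hf
      rw [hφe, hφe, one_mul]
      have h1 := abs_abs_sub_abs_le_abs_sub ((s : ℝ) - y) (s - x)
      rw [sub_sub_sub_cancel_left] at h1
      refine (abs_min_sub_min_le_max _ _ _ _).trans (max_le h1 ?_)
      rwa [sub_sub_sub_cancel_left, abs_sub_comm]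
    · simp only [φ, if_neg hf, sub_self, abs_zero, one_mul]
      exact abs_nonneg _)
    (fun q q' v h h' => (hv q v h).trans (hv q' v h').symm) p ⟨e, t⟩
  have hp0 : φ p = 0 := by
    rcases hp with rfl | ⟨h, h'⟩
    · simp [hφe, G.length_pos e |>.le]
    · simp [φ, if_neg h, h', (G.length_pos e).le]
  rw [hp0, sub_zero, one_mul, hφe] at key
  exact (le_abs_self _).trans key

/-- The mean distance of two points of a circle is a quarter of its length. -/
theorem sq_div_four_le_integral_min {l s : ℝ} (hs : s ∈ Icc 0 l) :
    l ^ 2 / 4 ≤ ∫ t in (0 : ℝ)..l, min |s - t| (l - |s - t|) := by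
  have hl : 0 ≤ l := hs.1.trans hs.2
  have hc : Continuous fun t => min |s - t| (l - |s - t|) := by fun_prop
  rw [← intervalIntegral.integral_add_adjacent_intervals (hc.intervalIntegrable 0 (l / 2))
    (hc.intervalIntegrable (l / 2) l)]
  -- Each `t` is paired with its antipode `t + l / 2`; the two circle distances from `s` add up to
  -- `l / 2`.
  have hshift : ∫ t in (l / 2)..l, min |s - t| (l - |s - t|) =
      ∫ t in (0 : ℝ)..(l / 2), min |s - (t + l / 2)| (l - |s - (t + l / 2)|) := by
    rw [intervalIntegral.integral_comp_add_right
      (f := fun t => min |s - t| (l - |s - t|))]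
    congr 1 <;> ring
  have hc' : Continuous fun t => min |s - (t + l / 2)| (l - |s - (t + l / 2)|) := by fun_prop
  rw [hshift, ← intervalIntegral.integral_add (hc.intervalIntegrable _ _)
    (hc'.intervalIntegrable _ _)]
  have hcst : ∫ _ in (0 : ℝ)..(l / 2), l / 2 = l ^ 2 / 4 := by
    rw [intervalIntegral.integral_const, smul_eq_mul]; ring
  rw [← hcst]
  refine intervalIntegral.integral_mono_on (by linarith) (by simp)
    ((hc.add hc').intervalIntegrable _ _) ?_
  rintro t ⟨ht0, ht1⟩
  have h0 := hs.1
  have h1 := hs.2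
  rcases abs_cases (s - t) with ⟨ha, -⟩ | ⟨ha, -⟩ <;>
  rcases abs_cases (s - (t + l / 2)) with ⟨hb, -⟩ | ⟨hb, -⟩ <;>
  rw [ha, hb] <;>
  rcases min_cases (s - t) (l - (s - t)) with ⟨hm, -⟩ | ⟨hm, -⟩ <;>
  grind

/-! ### Integration over the graph -/

theorem intervalIntegrable_comp_pt {f : G.Point → ℝ} (hf : Continuous f) (e : E) (a b : ℝ) :
    IntervalIntegrable (fun x => f (G.pt e x)) volume a b :=
  (hf.comp (G.continuous_pt e)).intervalIntegrable a b

theorem continuous_dist_right (p : G.Point) : Continuous fun q : G.Point => dist p q :=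
  continuous_const.dist continuous_id

section Integral

variable [Fintype E]

theorem totalLength_pos [Nonempty E] : 0 < G.totalLength :=
  Finset.sum_pos (fun e _ => G.length_pos e) Finset.univ_nonempty

theorem integral_mono {f g : G.Point → ℝ} (hf : Continuous f) (hg : Continuous g)
    (h : ∀ p, f p ≤ g p) : G.integral f ≤ G.integral g :=
  Finset.sum_le_sum fun e _ => intervalIntegral.integral_mono_on (G.length_pos e).le
    (G.intervalIntegrable_comp_pt hf e _ _) (G.intervalIntegrable_comp_pt hg e _ _)
    fun _ _ => h _

theorem integral_add {f g : G.Point → ℝ} (hf : Continuous f) (hg : Continuous g) :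
    G.integral (fun p => f p + g p) = G.integral f + G.integral g := by
  simp only [integral]
  rw [← Finset.sum_add_distrib]
  exact Finset.sum_congr rfl fun e _ => intervalIntegral.integral_add
    (G.intervalIntegrable_comp_pt hf e _ _) (G.intervalIntegrable_comp_pt hg e _ _)

theorem integral_const_mul (c : ℝ) (f : G.Point → ℝ) :
    G.integral (fun p => c * f p) = c * G.integral f := by
  simp only [integral, Finset.mul_sum, intervalIntegral.integral_const_mul]

theorem integral_const (c : ℝ) : G.integral (fun _ => c) = c * G.totalLength := by
  simp [integral, totalLength, Finset.mul_sum, mul_comm]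

theorem continuous_integral_dist : Continuous fun p : G.Point => G.integral fun q => dist p q := by
  refine continuous_finsetSum _ fun e _ => ?_
  refine intervalIntegral.continuous_parametric_intervalIntegral_of_continuous' ?_ _ _
  exact continuous_fst.dist ((G.continuous_pt e).comp continuous_snd)

theorem totalLength_sq_mul_meanDist [Nonempty E] :
    G.totalLength ^ 2 * G.meanDist = G.integral fun p => G.integral fun q => dist p q := by
  have hL := G.totalLength_pos.ne'
  have h : G.meanDistFrom = fun p => 1 / G.totalLength * G.integral fun q => dist p q := rfl
  rw [meanDist, h, integral_const_mul]
  field_simp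

theorem integral_sq_pos {u : G.Point → ℝ} (hu : Continuous u) (h0 : u ≠ 0) :
    0 < G.integral fun p => u p ^ 2 := by
  obtain ⟨⟨e, s⟩, hp⟩ := Function.ne_iff.1 h0
  refine Finset.sum_pos' (fun f _ => intervalIntegral.integral_nonneg (G.length_pos f).le
    fun _ _ => sq_nonneg _) ⟨e, Finset.mem_univ e, ?_⟩
  refine intervalIntegral.integral_pos (G.length_pos e)
    ((hu.comp (G.continuous_pt e)).pow 2).continuousOn (fun _ _ => sq_nonneg _) ⟨s, s.2, ?_⟩
  rw [G.pt_val]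
  exact sq_pos_of_ne_zero hp

theorem sum_sq_div_four_le_integral_dist (p : G.Point) :
    ∑ e, G.length e ^ 2 / 4 ≤ G.integral fun q => dist p q := by
  refine Finset.sum_le_sum fun e _ => ?_
  -- Seen from `e`, a point on another edge acts as the gluing point of the circle, that is,
  -- parameter `0`.
  obtain ⟨s, hs⟩ : ∃ s : Icc (0 : ℝ) (G.length e), p = ⟨e, s⟩ ∨ p.1 ≠ e ∧ (s : ℝ) = 0 := by
    obtain ⟨f, x⟩ := p
    by_cases hf : f = e
    · subst hf
      exact ⟨x, Or.inl rfl⟩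
    · exact ⟨⟨0, le_rfl, (G.length_pos e).le⟩, Or.inr ⟨hf, rfl⟩⟩
  refine (sq_div_four_le_integral_min s.2).trans ?_
  refine intervalIntegral.integral_mono_on (G.length_pos e).le
    (Continuous.intervalIntegrable (by fun_prop) _ _)
    (G.intervalIntegrable_comp_pt (G.continuous_dist_right p) e _ _) fun t ht => ?_
  rw [G.pt_of_mem ht]
  exact G.min_le_dist e s hs ⟨t, ht⟩

theorem totalLength_div_le_meanDist [Nonempty E] :
    G.totalLength / (4 * Fintype.card E) ≤ G.meanDist := by
  have hL := G.totalLength_pos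
  have hE : (0 : ℝ) < Fintype.card E := by exact_mod_cast Fintype.card_pos
  have h1 : G.totalLength ^ 2 ≤ Fintype.card E * ∑ e, G.length e ^ 2 := by
    simpa [totalLength] using sq_sum_le_card_mul_sum_sq (s := Finset.univ) (f := G.length)
  have h2 := G.integral_mono continuous_const G.continuous_integral_dist
    G.sum_sq_div_four_le_integral_dist
  rw [integral_const, ← totalLength_sq_mul_meanDist, ← Finset.sum_div] at h2
  have h3 : (∑ e, G.length e ^ 2) / 4 ≤ G.totalLength * G.meanDist :=
    le_of_mul_le_mul_right (by linarith [h2, sq (G.totalLength)]) hL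
  rw [div_le_iff₀ (by positivity)]
  refine le_of_mul_le_mul_left ?_ hL
  nlinarith [mul_le_mul_of_nonneg_left h3 hE.le]

end Integral

end MetricGraph

namespace MetricGraph

variable {V E : Type*} {G : MetricGraph V E}

/-! ### Energy estimates for functions in `H¹` -/

namespace IsH1WithDeriv

variable {u : G.Point → ℝ} {g : E → ℝ → ℝ}

theorem intervalIntegrable_sq (h : G.IsH1WithDeriv u g) (e : E) :
    IntervalIntegrable (fun t => g e t ^ 2) volume 0 (G.length e) := by
  rw [intervalIntegrable_iff_integrableOn_Ioo_of_le (G.length_pos e).le]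
  exact (h.memLp e).integrable_sq

theorem intervalIntegrable (h : G.IsH1WithDeriv u g) (e : E) :
    IntervalIntegrable (g e) volume 0 (G.length e) := by
  rw [intervalIntegrable_iff_integrableOn_Ioo_of_le (G.length_pos e).le]
  exact (h.memLp e).integrable one_le_two

theorem integral_eq_sub (h : G.IsH1WithDeriv u g) (e : E) {x y : ℝ}
    (hx : x ∈ Icc 0 (G.length e)) (hy : y ∈ Icc 0 (G.length e)) :
    ∫ t in x..y, g e t = u (G.pt e y) - u (G.pt e x) :=
  (h.weakDeriv e).integral_eq_sub (G.length_pos e)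
    (h.continuous.comp (G.continuous_pt e)).continuousOn (h.intervalIntegrable e) hx hy

variable (u g) in
/-- The energy density of `u` at the places where the value of `u` lies between `α` and `β`. -/
noncomputable def levelDensity (α β : ℝ) (e : E) : ℝ → ℝ :=
  {t | α < u (G.pt e t) ∧ u (G.pt e t) < β}.indicator fun t => g e t ^ 2

theorem levelDensity_nonneg (α β : ℝ) (e : E) (t : ℝ) : 0 ≤ levelDensity u g α β e t :=
  indicator_nonneg (fun _ _ => sq_nonneg _) t

theorem levelDensity_le (α β : ℝ) (e : E) (t : ℝ) : levelDensity u g α β e t ≤ g e t ^ 2 :=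
  indicator_le_self' (fun _ _ => sq_nonneg _) t

/-- Adjacent open bands are disjoint. Only an inequality results, because places with `u = γ` belong
to neither. -/
theorem levelDensity_add_le {α γ β : ℝ} (h1 : α ≤ γ) (h2 : γ ≤ β) (e : E) (t : ℝ) :
    levelDensity u g α γ e t + levelDensity u g γ β e t ≤ levelDensity u g α β e t := by
  have h0 := sq_nonneg (g e t)
  simp only [levelDensity, indicator_apply, mem_ofPred_eq]
  split_ifs <;> grind

theorem intervalIntegrable_levelDensity (h : G.IsH1WithDeriv u g) (α β : ℝ) (e : E) :
    IntervalIntegrable (levelDensity u g α β e) volume 0 (G.length e) := by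
  have hc : Continuous fun t => u (G.pt e t) := h.continuous.comp (G.continuous_pt e)
  have hm : MeasurableSet {t | α < u (G.pt e t) ∧ u (G.pt e t) < β} :=
    ((isOpen_lt continuous_const hc).inter (isOpen_lt hc continuous_const)).measurableSet
  have h2 := h.intervalIntegrable_sq e
  rw [intervalIntegrable_iff] at h2 ⊢
  exact h2.indicator hm

theorem sq_sub_le_on_edge (h : G.IsH1WithDeriv u g) (e : E) (s t : Icc (0 : ℝ) (G.length e))
    {α β : ℝ} (hαβ : α ≤ β) (hα : u ⟨e, s⟩ ≤ α) (hβ : β ≤ u ⟨e, t⟩) :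
    (β - α) ^ 2 ≤ |(s : ℝ) - t| * ∫ x in (0 : ℝ)..G.length e, levelDensity u g α β e x :=
  sq_sub_le_mul_integral_indicator (h.continuous.comp (G.continuous_pt e))
    (h.intervalIntegrable e) (h.intervalIntegrable_sq e)
    (fun _ hx _ hy => h.integral_eq_sub e hx hy) s.2 t.2 hαβ
    (by rwa [Function.comp_apply, G.pt_val]) (by rwa [Function.comp_apply, G.pt_val])

theorem integral_levelDensity_nonneg (α β : ℝ) (e : E) :
    0 ≤ ∫ x in (0 : ℝ)..G.length e, levelDensity u g α β e x :=
  intervalIntegral.integral_nonneg (G.length_pos e).le fun _ _ => levelDensity_nonneg _ _ _ _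

variable [Fintype E]

variable (u g) in
/-- The energy of `u` at the places where the value of `u` lies between `α` and `β`. -/
noncomputable def levelEnergy (α β : ℝ) : ℝ :=
  ∑ e, ∫ x in (0 : ℝ)..G.length e, levelDensity u g α β e x

theorem levelEnergy_nonneg (α β : ℝ) : 0 ≤ levelEnergy u g α β :=
  Finset.sum_nonneg fun e _ => integral_levelDensity_nonneg α β e

theorem levelEnergy_le (h : G.IsH1WithDeriv u g) (α β : ℝ) :
    levelEnergy u g α β ≤ ∑ e, ∫ x in (0 : ℝ)..G.length e, g e x ^ 2 :=
  Finset.sum_le_sum fun e _ => intervalIntegral.integral_mono_on (G.length_pos e).le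
    (h.intervalIntegrable_levelDensity α β e) (h.intervalIntegrable_sq e)
    fun _ _ => levelDensity_le _ _ _ _

theorem levelEnergy_add_le (h : G.IsH1WithDeriv u g) {α γ β : ℝ} (h1 : α ≤ γ) (h2 : γ ≤ β) :
    levelEnergy u g α γ + levelEnergy u g γ β ≤ levelEnergy u g α β := by
  simp only [levelEnergy]
  rw [← Finset.sum_add_distrib]
  refine Finset.sum_le_sum fun e _ => ?_
  rw [← intervalIntegral.integral_add (h.intervalIntegrable_levelDensity α γ e)
    (h.intervalIntegrable_levelDensity γ β e)]
  exact intervalIntegral.integral_mono_on (G.length_pos e).le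
    ((h.intervalIntegrable_levelDensity α γ e).add (h.intervalIntegrable_levelDensity γ β e))
    (h.intervalIntegrable_levelDensity α β e) fun t _ => levelDensity_add_le h1 h2 e t

theorem sq_sub_le_on_edge' (h : G.IsH1WithDeriv u g) (e : E) (s t : Icc (0 : ℝ) (G.length e))
    {α β : ℝ} (hαβ : α ≤ β) (hα : u ⟨e, s⟩ ≤ α) (hβ : β ≤ u ⟨e, t⟩) :
    (β - α) ^ 2 ≤ |(s : ℝ) - t| * levelEnergy u g α β :=
  (h.sq_sub_le_on_edge e s t hαβ hα hβ).trans <| mul_le_mul_of_nonneg_left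
    (Finset.single_le_sum (f := fun e => ∫ x in (0 : ℝ)..G.length e, levelDensity u g α β e x)
      (fun e _ => integral_levelDensity_nonneg α β e) (Finset.mem_univ e)) (abs_nonneg _)

/-- Cauchy-Schwarz in the plane for `(√r, √s)` and `(√A, √B)`: it joins two pieces of a path, with
lengths `r`, `s` and energies `A`, `B`. -/
theorem _root_.MetricGraph.add_sq_le_mul_of_sq_le_mul {x y r s A B C : ℝ} (hr : 0 ≤ r)
    (hs : 0 ≤ s) (hA : 0 ≤ A) (hB : 0 ≤ B) (hC : A + B ≤ C) (hx : x ^ 2 ≤ r * A)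
    (hy : y ^ 2 ≤ s * B) : (x + y) ^ 2 ≤ (r + s) * C := by
  refine le_trans ?_ (mul_le_mul_of_nonneg_left hC (add_nonneg hr hs))
  have h1 : 2 * (x * y) ≤ r * B + s * A := by
    refine le_of_sq_le_sq ?_ (by positivity)
    have h2 : (x * y) ^ 2 ≤ (r * A) * (s * B) := by
      rw [mul_pow]; exact mul_le_mul hx hy (sq_nonneg _) (mul_nonneg hr hA)
    nlinarith [sq_nonneg (r * B - s * A)]
  nlinarith

/-- The level sets argument: on a path which may cross a place several times, only the first
crossing of every level is used. -/
theorem sq_sub_le_mul_levelEnergy (h : G.IsH1WithDeriv u g) {p q : G.Point} {r : ℝ}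
    (hr : G.Path p q r) {α β : ℝ} (hαβ : α ≤ β) (hα : u p ≤ α) (hβ : β ≤ u q) :
    (β - α) ^ 2 ≤ r * levelEnergy u g α β := by
  induction hr generalizing β with
  | refl => simp [le_antisymm (hβ.trans hα) hαβ]
  | @along r e s t hpath ih =>
    -- If level `β` is reached before the last segment, that segment is superfluous; if its start is
    -- still at or below `α`, it suffices alone. Otherwise the band is split at the value `u ⟨e,
    -- s⟩`, the earlier path paying for the lower part and the segment for the upper.
    rcases le_total β (u ⟨e, s⟩) with h1 | h1
    · refine (ih hαβ h1).trans (mul_le_mul_of_nonneg_right ?_ (levelEnergy_nonneg α β))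
      exact le_add_of_nonneg_right (abs_nonneg _)
    rcases le_total (u ⟨e, s⟩) α with h2 | h2
    · refine (h.sq_sub_le_on_edge' e s t hαβ h2 hβ).trans
        (mul_le_mul_of_nonneg_right ?_ (levelEnergy_nonneg α β))
      exact le_add_of_nonneg_left hpath.nonneg
    · have := add_sq_le_mul_of_sq_le_mul hpath.nonneg (abs_nonneg _)
        (levelEnergy_nonneg α (u ⟨e, s⟩)) (levelEnergy_nonneg (u ⟨e, s⟩) β)
        (h.levelEnergy_add_le h2 h1) (ih h2 le_rfl) (h.sq_sub_le_on_edge' e s t h1 le_rfl hβ)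
      convert this using 2
      ring
  | @cross q q' r v _ h1 h2 ih =>
    -- Points at one vertex are distinct but at distance `0`; continuity for the pseudo-metric
    -- forces equal values.
    have : u q = u q' := ((Metric.inseparable_iff.2
      (G.dist_eq_zero_of_atVertex h1 h2)).map h.continuous).eq
    exact ih hαβ (this ▸ hβ)

theorem sq_sub_le_mul_dist (h : G.IsH1WithDeriv u g) (p q : G.Point) :
    (u q - u p) ^ 2 ≤ (∑ e, ∫ x in (0 : ℝ)..G.length e, g e x ^ 2) * dist p q := by
  have hN := (levelEnergy_nonneg 0 0).trans (h.levelEnergy_le 0 0)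
  wlog hle : u p ≤ u q generalizing p q
  · rw [← neg_sub, neg_sq, dist_comm]
    exact this q p (le_of_not_ge hle)
  refine G.le_mul_dist hN fun r hr => ?_
  rw [mul_comm]
  exact (h.sq_sub_le_mul_levelEnergy hr hle le_rfl le_rfl).trans
    (mul_le_mul_of_nonneg_left (h.levelEnergy_le _ _) hr.nonneg)

theorem two_mul_integral_sq_le [Nonempty E] (h : G.IsH1WithDeriv u g) (h0 : G.integral u = 0) :
    2 * G.integral (fun p => u p ^ 2) ≤
      (∑ e, ∫ x in (0 : ℝ)..G.length e, g e x ^ 2) * (G.totalLength * G.meanDist) := by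
  set N := ∑ e, ∫ x in (0 : ℝ)..G.length e, g e x ^ 2
  set D := G.integral fun p => u p ^ 2 with hD
  have hu := h.continuous
  -- The Hölder estimate is integrated in `q` with `p` fixed; the term `-2 * u p * u q` vanishes by
  -- the zero mean.
  have h1 : ∀ p, G.totalLength * u p ^ 2 + D ≤ N * G.integral fun q => dist p q := by
    intro p
    have h2 := G.integral_mono (f := fun q => (u q ^ 2 + (-2 * u p) * u q) + u p ^ 2)
      (g := fun q => N * dist p q) (by fun_prop)
      (continuous_const.mul (G.continuous_dist_right p)) fun q =>
        le_trans (le_of_eq (by ring)) (h.sq_sub_le_mul_dist p q)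
    rw [G.integral_add (by fun_prop) continuous_const, G.integral_add (by fun_prop) (by fun_prop),
      integral_const_mul, integral_const_mul, h0, integral_const] at h2
    linarith
  have h3 := G.integral_mono (g := fun p => N * G.integral fun q => dist p q) (by fun_prop)
    (continuous_const.mul G.continuous_integral_dist) h1
  rw [G.integral_add (by fun_prop) continuous_const, integral_const_mul, integral_const_mul,
    integral_const, ← totalLength_sq_mul_meanDist] at h3
  refine le_of_mul_le_mul_left ?_ G.totalLength_pos
  linarith

end IsH1WithDeriv

/-! ### The spectral gap -/

variable (G) in
/-- The function `t ↦ sin (2 π t / ℓ)` on one edge, continued by zero, is in `H¹`. -/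
theorem exists_isH1WithDeriv [Fintype E] [Nonempty E] :
    ∃ (u : G.Point → ℝ) (g : E → ℝ → ℝ), G.IsH1WithDeriv u g ∧ G.integral u = 0 ∧ u ≠ 0 := by
  classical
  obtain ⟨e⟩ := ‹Nonempty E›
  set l := G.length e with hl
  have hl0 : 0 < l := G.length_pos e
  -- One full period on the edge: the sine vanishes at both ends, so extension by zero is
  -- continuous, and its integral is zero.
  set k := 2 * Real.pi / l with hk
  have hk0 : 0 < k := by positivity
  have hkl : k * l = 2 * Real.pi := by rw [hk]; field_simp
  let u : G.Point → ℝ := fun p => if p.1 = e then Real.sin (k * p.2) else 0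
  let g : E → ℝ → ℝ := fun f t => if f = e then k * Real.cos (k * t) else 0
  have hue : ∀ t ∈ Icc 0 l, u (G.pt e t) = Real.sin (k * t) := fun t ht => by
    rw [G.pt_of_mem ht]; exact if_pos rfl
  have huf : ∀ f ≠ e, ∀ t, u (G.pt f t) = 0 := fun f hf t => if_neg hf
  have hge : g e = fun t => k * Real.cos (k * t) := funext fun t => if_pos rfl
  have hgf : ∀ f ≠ e, g f = fun _ => 0 := fun f hf => funext fun t => if_neg hf
  have hder : ∀ t, HasDerivAt (fun t => Real.sin (k * t)) (k * Real.cos (k * t)) t := fun t => by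
    simpa [mul_comm] using ((hasDerivAt_id t).const_mul k).sin
  have hvert : ∀ (p : G.Point) (v : V), p.AtVertex v → u p = 0 := by
    rintro ⟨f, x⟩ v hp
    by_cases hf : f = e
    · subst hf
      have : u ⟨f, x⟩ = Real.sin (k * x) := if_pos rfl
      rw [this]
      rcases hp with ⟨h, -⟩ | ⟨h, -⟩ <;> simp only at h <;> rw [h]
      · simp
      · rw [← hl, hkl, Real.sin_two_pi]
    · exact if_neg hf
  have hlip : LipschitzWith k.toNNReal u := LipschitzWith.of_dist_le_mul fun p q => by
    rw [Real.coe_toNNReal k hk0.le, dist_comm, Real.dist_eq]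
    refine G.abs_sub_le_mul_dist hk0.le (fun f s t => ?_)
      (fun p q v hp hq => (hvert p v hp).trans (hvert q v hq).symm) p q
    by_cases hf : f = e
    · subst hf
      have h1 : ∀ x, u ⟨f, x⟩ = Real.sin (k * x) := fun x => if_pos rfl
      rw [h1, h1]
      refine (Real.abs_sin_sub_sin_le _ _).trans ?_
      rw [← mul_sub, abs_mul, abs_of_pos hk0, abs_sub_comm]
    · have h1 : ∀ x, u ⟨f, x⟩ = 0 := fun x => if_neg hf
      rw [h1, h1, sub_self, abs_zero]
      positivity
  refine ⟨u, g, ⟨hlip.continuous, fun f => ?_, fun f φ h1 h2 h3 => ?_⟩, ?_, fun h => ?_⟩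
  · by_cases hf : f = e
    · subst hf
      rw [hge]
      refine MemLp.of_bound (by fun_prop) k (Filter.Eventually.of_forall fun t => ?_)
      rw [norm_mul, Real.norm_of_nonneg hk0.le]
      exact mul_le_of_le_one_right hk0.le (Real.abs_cos_le_one _)
    · rw [hgf f hf]
      exact MemLp.zero
  · by_cases hf : f = e
    · subst hf
      have ha : φ 0 = 0 := by_contra fun hne => lt_irrefl _ (h3 (subset_tsupport _ hne)).1
      have hb : φ l = 0 := by_contra fun hne => lt_irrefl _ (h3 (subset_tsupport _ hne)).2
      have hcongr : ∫ x in (0 : ℝ)..l, u (G.pt f x) * deriv φ x =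
          ∫ x in (0 : ℝ)..l, Real.sin (k * x) * deriv φ x :=
        intervalIntegral.integral_congr fun t ht => by
          rw [uIcc_of_le hl0.le] at ht
          simp only [hue t ht]
      rw [← hl, hcongr, hge, intervalIntegral.integral_mul_deriv_eq_deriv_mul
        (fun x _ => hder x) (fun x _ => ((h1.differentiable (by simp)) x).hasDerivAt)
        (Continuous.intervalIntegrable (by fun_prop) _ _)
        ((h1.continuous_deriv (by simp)).intervalIntegrable _ _), ha, hb]
      simp
    · rw [hgf f hf]
      simp [huf f hf]
  · refine Finset.sum_eq_zero fun f _ => ?_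
    by_cases hf : f = e
    · subst hf
      have hcongr : ∫ x in (0 : ℝ)..l, u (G.pt f x) = ∫ x in (0 : ℝ)..l, Real.sin (k * x) :=
        intervalIntegral.integral_congr fun t ht => by
          rw [uIcc_of_le hl0.le] at ht
          exact hue t ht
      rw [← hl, hcongr, intervalIntegral.integral_comp_mul_left _ hk0.ne', hkl]
      simp
    · simp [huf f hf]
  · have h4 := hue (l / 4) ⟨by linarith, by linarith⟩
    rw [h, show k * (l / 4) = Real.pi / 2 by linarith, Real.sin_pi_div_two] at h4
    exact zero_ne_one h4

variable (G) in
theorem two_div_le_spectralGap [Fintype E] [Nonempty E] (hρ : 0 < G.meanDist) :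
    2 / (G.totalLength * G.meanDist) ≤ G.spectralGap := by
  have hL := G.totalLength_pos
  -- A competitor is needed because the real `sInf` of the empty set is `0`, which would violate the
  -- bound.
  obtain ⟨u, g, h1, h2, h3⟩ := G.exists_isH1WithDeriv
  refine le_csInf ⟨_, u, g, h1, h2, h3, rfl⟩ ?_
  rintro r ⟨u, g, h1, h2, h3, rfl⟩
  rw [div_le_div_iff₀ (by positivity) (G.integral_sq_pos h1.continuous h3)]
  exact h1.two_mul_integral_sq_le h2

end MetricGraph

/-! ### Combination of the two bounds -/

theorem mainTheorem5 {V E : Type*} [Finite V] [Fintype E] [Nonempty E] (G : MetricGraph V E) :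
    (2 * (Fintype.card E : ℝ) - 1) / (4 * (Fintype.card E : ℝ) ^ 2) ≤
      G.spectralGap * G.meanDist ^ 2 := by
  have hL := G.totalLength_pos
  have hE : (0 : ℝ) < Fintype.card E := by exact_mod_cast Fintype.card_pos
  have h1 := G.totalLength_div_le_meanDist
  have hρ : 0 < G.meanDist := lt_of_lt_of_le (by positivity) h1
  calc (2 * (Fintype.card E : ℝ) - 1) / (4 * (Fintype.card E : ℝ) ^ 2)
      -- The argument yields `2 E` in the numerator, so the `-1` is simply dropped.
      ≤ 2 * (Fintype.card E : ℝ) / (4 * (Fintype.card E : ℝ) ^ 2) := by gcongr; linarith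
    _ = 2 / G.totalLength * (G.totalLength / (4 * Fintype.card E)) := by field_simp
    _ ≤ 2 / G.totalLength * G.meanDist := by gcongr
    _ = 2 / (G.totalLength * G.meanDist) * G.meanDist ^ 2 := by field_simp
    _ ≤ G.spectralGap * G.meanDist ^ 2 := by
        gcongr
        exact G.two_div_le_spectralGap hρ
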